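/- Let $\underline{w}=\{w_k\}_{k\in\mathbb Z}\subseteq\mathbb C$ be arbitrary, and let $\{e_k\}_{k\in\mathbb Z}$ be the standard orthonormal basis of $\ell^2(\mathbb Z)$. The (not necessarily bounded) bilateral weighted shift operator $S_{\underline w}$ is defined on the domain $$\operatorname{dom} S_{\underline w}=\Big\{\sum_{k}\xi_k e_k : \sum_{k}|\xi_k|^2<\infty,\ \sum_{k}|\xi_k w_k|^2<\infty\Big\}\quad\text{by}\quad S_{\underline w}\Big(\sum_{k}\xi_k e_k\Big)=\sum_{k}\xi_{k-1}w_{k-1}e_k .$$ Two (possibly unbounded) operators $A,B$ in a Hilbert space $\mathcal H$ are called similar if there is a bounded linear bijection $X\colon\mathcal H\to\mathcal H$ with bounded inverse such that $X(\operatorname{dom}A)=\operatorname{dom}B$ and $XAh=BXh$ for all $h\in\operatorname{dom}A$. A (possibly unbounded) operator $N$ is normal if it is densely defined, $\operatorname{dom}N=\operatorname{dom}N^*$ and $\|Nx\|=\|N^*x\|$ for all $x\in\operatorname{dom}N$ (equivalently, $N$ is closed, densely defined and $N^*N=NN^*$). Suppose that $S_{\underline w}$ is injective and similar to a normal operator in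 $\ell^2(\mathbb Z)$. Then: 1. $S_{\underline w}$ is a bounded operator defined on the whole of $\ell^2(\mathbb Z)$; 2. $S_{\underline w}$ is cyclic, i.e. there is a vector $x$ such that the linear span of $\{S_{\underline w}^n x : n\ge 0\}$ is dense in $\ell^2(\mathbb Z)$; 3. $S_{\underline w}$ is not supercyclic, i.e. there is no vector $x$ such that $\{c\,S_{\underline w}^n x : c\in\mathbb C,\ n\ge 0\}$ is dense in $\ell^2(\mathbb Z)$; 4. the spectrum of $S_{\underline w}$ is a circle centred at $0$: there is $r>0$ with $\sigma(S_{\underline w})=\{z\in\mathbb C : |z|=r\}$. -/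

import Mathlib

open scoped LinearPMap

noncomputable section

/-- The complex Hilbert space `ℓ²(ℤ)`. -/
abbrev EllTwo : Type := lp (fun _ : ℤ => ℂ) 2

/-- The square-summable sequences `ξ` for which `(w k * ξ k)` is square-summable as well:
the domain of the bilateral weighted shift with weights `w`. -/
def weightedShiftDomain (w : ℤ → ℂ) : Submodule ℂ EllTwo where
  carrier := {ξ | Memℓp (fun k : ℤ => w k * ξ k) 2}
  zero_mem' := by
    have h : (fun k : ℤ => w k * (0 : EllTwo) k) = 0 := by
      funext k
      simp
    simpa only [Set.mem_ofPred_eq, h] using (zero_memℓp (E := fun _ : ℤ => ℂ) (p := 2))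
  add_mem' := by
    intro a b ha hb
    have h : (fun k : ℤ => w k * (a + b) k)
        = (fun k : ℤ => w k * a k) + (fun k : ℤ => w k * b k) := by
      funext k
      simp [mul_add]
    simpa only [Set.mem_ofPred_eq, h] using Memℓp.add ha hb
  smul_mem' := by
    intro c a ha
    have h : (fun k : ℤ => w k * (c • a) k) = c • (fun k : ℤ => w k * a k) := by
      funext k
      simp [mul_left_comm]
    simpa only [Set.mem_ofPred_eq, h] using Memℓp.const_smul ha c

/-- Square-summability on `ℤ` is invariant under translation of the index. -/
theorem memℓp_two_shift {f : ℤ → ℂ} (hf : Memℓp f 2) :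
    Memℓp (fun k : ℤ => f (k - 1)) 2 := by
  have h2 : 0 < (2 : ENNReal).toReal := by norm_num
  rw [memℓp_gen_iff h2] at hf ⊢
  exact (Equiv.summable_iff (Equiv.subRight (1 : ℤ))).mpr hf

/-- The (possibly unbounded) bilateral weighted shift on `ℓ²(ℤ)` with weights `w`, on its natural
domain: `(S_w ξ) k = w (k - 1) * ξ (k - 1)`, that is, `S_w e_k = w_k e_{k+1}`. -/
def weightedShift (w : ℤ → ℂ) : EllTwo →ₗ.[ℂ] EllTwo where
  domain := weightedShiftDomain w
  toFun :=
    { toFun := fun ξ =>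
        ⟨fun k : ℤ => w (k - 1) * (ξ : EllTwo) (k - 1),
          memℓp_two_shift (f := fun k : ℤ => w k * (ξ : EllTwo) k) ξ.2⟩
      map_add' := by
        intro a b
        ext k
        exact mul_add _ _ _
      map_smul' := by
        intro c a
        ext k
        simp [mul_left_comm] }

section Operators

variable {H : Type*} [NormedAddCommGroup H] [InnerProductSpace ℂ H] [CompleteSpace H]

/-- A (possibly unbounded) normal operator in a Hilbert space: a densely defined operator `N` with
`dom N = dom N†` and `‖N x‖ = ‖N† x‖` for every `x` in this common domain. (This textbook definition
is equivalent to: `N` is closed, densely defined, and `N† N = N N†` with natural domains.) -/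
structure IsNormalOperator (N : H →ₗ.[ℂ] H) : Prop where
  dense_domain : Dense (N.domain : Set H)
  domain_eq : N.domain = N†.domain
  norm_eq : ∀ (x : N.domain) (y : N†.domain), (x : H) = (y : H) → ‖N x‖ = ‖N† y‖

/-- Two (possibly unbounded) operators `A`, `B` in `H` are similar if there is an invertible
operator `X` on `H` (bounded, everywhere defined, with such an inverse) with `X (dom A) = dom B`
and `X A h = B X h` for all `h` in `dom A`. -/
def AreSimilar (A B : H →ₗ.[ℂ] H) : Prop :=
  ∃ X : H ≃L[ℂ] H, X '' (A.domain : Set H) = (B.domain : Set H) ∧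
    ∀ (h : A.domain) (g : B.domain), (g : H) = X (h : H) → X (A h) = B g

/-- A bounded operator `T` is cyclic if for some vector `x` the linear span of its orbit
`x, T x, T² x, …` is dense. -/
def IsCyclicOperator (T : H →L[ℂ] H) : Prop :=
  ∃ x : H, Dense (Submodule.span ℂ (Set.range fun n : ℕ => (T ^ n) x) : Set H)

/-- A bounded operator `T` is supercyclic if for some vector `x` the set of all scalar multiples
of the elements of its orbit `x, T x, T² x, …` is dense. -/
def IsSupercyclicOperator (T : H →L[ℂ] H) : Prop :=
  ∃ x : H, Dense {y : H | ∃ (c : ℂ) (n : ℕ), y = c • (T ^ n) x}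

end Operators

end

/-!
Let `N` be normal and `N X = X S_w` with `X` invertible. The vectors `f_k = X e_k` and the
biorthogonal vectors `g_k = (X⁻¹)* e_k` satisfy `N f_k = w_k f_{k+1}` and
`N† g_{k+1} = conj w_k • g_k`. A normal operator obeys `‖N x‖² ≤ ‖N² x‖ ‖x‖`, and so does its adjoint
(`IsNormalOperator.norm_apply_sq_le`, `IsNormalOperator.norm_adjoint_apply_sq_le`). Applied to `f_k`
and `g_k`, these inequalities say that `|w_k| ‖f_{k+1}‖ / ‖f_k‖` is nondecreasing in `k` while
`|w_k| ‖g_k‖ / ‖g_{k+1}‖` is nonincreasing. The quotient of the two is the ratio of successive terms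
of the bounded sequence `‖f_k‖ ‖g_k‖`, and a positive bounded log-convex sequence on `ℤ` is constant
(`ratio_eq_one_of_logConvex`). Therefore `|w_k| = r ‖f_k‖ / ‖f_{k+1}‖` with a constant `r > 0`
(`exists_norm_weight_eq`). Hence `S_w` is bounded and everywhere defined, and an invertible diagonal
operator conjugates it to `r U`, where `U` is the unweighted bilateral shift
(`exists_similar_bilateralShift`). The remaining assertions are properties of `r U`.

The spectrum of the unitary `U` is nonempty, lies in the unit circle and is invariant under
rotations, so it is the circle (`spectrum_bilateralShift`). No multiple of `U` is supercyclic, because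
the ratio of `⟪y, U y⟫` to `‖y‖²` is constant along projective orbits
(`not_isSupercyclic_smul_bilateralShift`).

For cyclicity, `U` is viewed as multiplication by `z` on `L²` of the circle. The cyclic vector is
`f(z) = exp (-1 / |1 - z|²)`. The closed invariant subspace generated by `f` contains `f / z`: the
function `h = exp (n (2 s z / (1 - s z)))`, with `s < 1`, is analytic near the closed disc and
`h(0) = 1`, so `(1 - h) f / z` belongs to the subspace; and `|h f| ≤ exp (-n)` on the whole circle
once `8 n (1 - s) ≤ 1`, by an estimate of the Poisson kernel (`exists_mem_elemental_norm_le`). So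
the subspace contains all `z ^ k f` with `k` in `ℤ`, and it is everything because `f` vanishes at
one point only.
-/

open scoped Pointwise

noncomputable section

/-! ### Norm inequalities for unbounded normal operators -/

section Normal

variable {H : Type*} [NormedAddCommGroup H] [InnerProductSpace ℂ H] [CompleteSpace H]

/-- The inequality `‖N x‖² ≤ ‖N² x‖ ‖x‖` for `x` in the domain of `N²`. As `N x` lies in
`dom N = dom N†`, one has `‖N x‖² = ⟪N† N x, x⟫` and `‖N† N x‖ = ‖N² x‖`. -/
theorem IsNormalOperator.norm_apply_sq_le {N : H →ₗ.[ℂ] H} (hN : IsNormalOperator N)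
    (x y : N.domain) (hxy : N x = y) : ‖N x‖ ^ 2 ≤ ‖N y‖ * ‖(x : H)‖ := by
  have hy : (y : H) ∈ N†.domain := hN.domain_eq ▸ y.2
  have h1 : inner ℂ (N† ⟨y, hy⟩) (x : H) = inner ℂ (y : H) (N x) :=
    N.adjoint_isFormalAdjoint hN.dense_domain ⟨y, hy⟩ x
  calc ‖N x‖ ^ 2 = ‖inner ℂ (y : H) (N x)‖ := by
        rw [← hxy, inner_self_eq_norm_sq_to_K, norm_pow, RCLike.norm_ofReal, abs_norm]
    _ ≤ ‖N† ⟨y, hy⟩‖ * ‖(x : H)‖ := by rw [← h1]; exact norm_inner_le_norm _ _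
    _ = ‖N y‖ * ‖(x : H)‖ := by rw [hN.norm_eq y ⟨y, hy⟩ rfl]

/-- The companion inequality for the adjoint of a normal operator; it is derived directly, without
using that the adjoint is normal. -/
theorem IsNormalOperator.norm_adjoint_apply_sq_le {N : H →ₗ.[ℂ] H} (hN : IsNormalOperator N)
    (x y : N†.domain) (hxy : N† x = y) : ‖N† x‖ ^ 2 ≤ ‖N† y‖ * ‖(x : H)‖ := by
  have hy : (y : H) ∈ N.domain := hN.domain_eq.symm ▸ y.2
  have h1 : inner ℂ (N† x) (y : H) = inner ℂ (x : H) (N ⟨y, hy⟩) :=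
    N.adjoint_isFormalAdjoint hN.dense_domain x ⟨y, hy⟩
  calc ‖N† x‖ ^ 2 = ‖inner ℂ (N† x) (y : H)‖ := by
        rw [← hxy, inner_self_eq_norm_sq_to_K, norm_pow, RCLike.norm_ofReal, abs_norm]
    _ ≤ ‖(x : H)‖ * ‖N ⟨y, hy⟩‖ := by rw [h1]; exact norm_inner_le_norm _ _
    _ = ‖N† y‖ * ‖(x : H)‖ := by rw [hN.norm_eq ⟨y, hy⟩ y rfl, mul_comm]

end Normal

/-! ### Log-convex sequences on the integers -/

section Sequences

/-- A positive bounded log-convex function on `ℤ` is constant: its successive ratios are monotone,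
and a ratio different from `1` forces geometric growth towards `+∞` or `-∞`. -/
theorem ratio_eq_one_of_logConvex {s : ℤ → ℝ} (hpos : ∀ k, 0 < s k) {C : ℝ} (hC : ∀ k, s k ≤ C)
    (hmono : Monotone fun k => s (k + 1) / s k) (k : ℤ) : s (k + 1) / s k = 1 := by
  -- The case of growth to the right, applied to `s` and to its reflection `k ↦ s (-k)`.
  have key : ∀ (t : ℤ → ℝ) (ρ : ℝ), (∀ k, 0 < t k) → (∀ k, t k ≤ C) → 1 < ρ → ∀ k₀ : ℤ,
      (∀ k, k₀ ≤ k → ρ * t k ≤ t (k + 1)) → False := by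
    intro t ρ ht htC hρ k₀ hk
    have hn : ∀ n : ℕ, ρ ^ n * t k₀ ≤ t (k₀ + n) := by
      intro n
      induction n with
      | zero => simp
      | succ n ih =>
        have := hk (k₀ + n) (by omega)
        push_cast
        rw [← add_assoc]
        calc ρ ^ (n + 1) * t k₀ = ρ * (ρ ^ n * t k₀) := by ring
          _ ≤ ρ * t (k₀ + n) := by gcongr
          _ ≤ _ := this
    obtain ⟨n, h⟩ := pow_unbounded_of_one_lt (C / t k₀) hρ
    rw [div_lt_iff₀ (ht k₀)] at h
    linarith [hn n, htC (k₀ + n)]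
  rcases lt_trichotomy (s (k + 1) / s k) 1 with h | h | h
  · exfalso
    have hq : 0 < s (k + 1) / s k := div_pos (hpos _) (hpos _)
    refine key (fun j => s (-j)) (s (k + 1) / s k)⁻¹ (fun j => hpos _) (fun j => hC _)
      ((one_lt_inv₀ hq).2 h) (-(k + 1)) fun j hj => ?_
    have h1 : s (-(j + 1) + 1) / s (-(j + 1)) ≤ s (k + 1) / s k := hmono (by omega)
    rw [show -(j + 1) + 1 = -j by ring, div_le_iff₀ (hpos _)] at h1
    rw [inv_mul_le_iff₀ hq]
    exact h1
  · exact h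
  · exfalso
    refine key s (s (k + 1) / s k) hpos hC h k fun j hj => ?_
    have h1 : s (k + 1) / s k ≤ s (j + 1) / s j := hmono hj
    rwa [le_div_iff₀ (hpos _)] at h1

/-- The weights `a` are `r`-multiples of a coboundary as soon as they satisfy the two log-convexity
inequalities that a normal operator and its adjoint impose. -/
theorem exists_eq_mul_div_of_logConvex {a d h : ℤ → ℝ} (ha : ∀ k, 0 < a k) (hd : ∀ k, 0 < d k)
    (hh : ∀ k, 0 < h k) {C : ℝ} (hC : ∀ k, d k * h k ≤ C)
    (h1 : ∀ k, (a k * d (k + 1)) ^ 2 ≤ a k * a (k + 1) * d (k + 2) * d k)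
    (h2 : ∀ k, (a (k + 1) * h (k + 1)) ^ 2 ≤ a (k + 1) * a k * h k * h (k + 2)) :
    ∃ r : ℝ, 0 < r ∧ ∀ k, a k = r * (d k / d (k + 1)) := by
  -- `p` is nondecreasing, `q` is nonincreasing, and `p / q` is the ratio of successive terms of the
  -- bounded sequence `d h`, so that `p = q` and both are constant.
  set p : ℤ → ℝ := fun k => a k * d (k + 1) / d k with hp
  set q : ℤ → ℝ := fun k => a k * h k / h (k + 1) with hq
  have hppos : ∀ k, 0 < p k := fun k => div_pos (mul_pos (ha _) (hd _)) (hd _)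
  have hqpos : ∀ k, 0 < q k := fun k => div_pos (mul_pos (ha _) (hh _)) (hh _)
  have pmono : Monotone p := by
    refine monotone_int_of_le_succ fun k => ?_
    simp only [hp]
    rw [div_le_div_iff₀ (hd _) (hd _), show k + 1 + 1 = k + 2 by ring]
    refine le_of_mul_le_mul_left ?_ (ha k)
    linarith [h1 k]
  have qanti : Antitone q := by
    refine antitone_int_of_succ_le fun k => ?_
    simp only [hq]
    rw [div_le_div_iff₀ (hh _) (hh _), show k + 1 + 1 = k + 2 by ring]
    refine le_of_mul_le_mul_left ?_ (ha (k + 1))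
    linarith [h2 k]
  have hratio : ∀ k, d (k + 1) * h (k + 1) / (d k * h k) = p k / q k := by
    intro k
    have := (ha k).ne'; have := (hd k).ne'; have := (hh k).ne'
    have := (hd (k + 1)).ne'; have := (hh (k + 1)).ne'
    simp only [hp, hq]
    field_simp
  have hone : ∀ k, p k = q k := by
    intro k
    have := ratio_eq_one_of_logConvex (s := fun k => d k * h k) (fun k => mul_pos (hd k) (hh k)) hC
      (by
        simp only [hratio]
        intro i j hij
        exact div_le_div₀ (hppos j).le (pmono hij) (hqpos j) (qanti hij)) k
    rw [hratio, div_eq_one_iff_eq (hqpos k).ne'] at this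
    exact this
  have hconst : ∀ k, p k = p 0 := by
    intro k
    rcases le_total 0 k with hk | hk
    · exact le_antisymm (by rw [hone k, hone 0]; exact qanti hk) (pmono hk)
    · exact le_antisymm (pmono hk) (by rw [hone k, hone 0]; exact qanti hk)
  refine ⟨p 0, hppos 0, fun k => ?_⟩
  rw [← hconst k]
  have := (hd k).ne'; have := (hd (k + 1)).ne'
  simp only [hp]
  field_simp

/-- A first-order multiplicative recursion on `ℤ` with nonzero coefficients can be solved in both
directions from the value `1` at `0`. -/
theorem exists_int_mul_recursion {v : ℤ → ℂ} (hv : ∀ k, v k ≠ 0) :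
    ∃ c : ℤ → ℂ, c 0 = 1 ∧ ∀ k, c (k + 1) = c k * v k := by
  refine ⟨fun k => (∏ i ∈ Finset.Ico 0 k, v i) / ∏ i ∈ Finset.Ico k 0, v i, by simp, fun k => ?_⟩
  rcases le_or_gt 0 k with hk | hk
  · simp only [Finset.Ico_eq_empty_of_le hk,
      Finset.Ico_eq_empty_of_le (show (0 : ℤ) ≤ k + 1 by omega), Finset.prod_empty, div_one]
    rw [← Finset.insert_Ico_right_eq_Ico_add_one hk, Finset.prod_insert (by simp), mul_comm]
  · simp only [Finset.Ico_eq_empty_of_le hk.le,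
      Finset.Ico_eq_empty_of_le (show k + 1 ≤ (0 : ℤ) by omega)]
    have h : ∏ i ∈ Finset.Ico k 0, v i = v k * ∏ i ∈ Finset.Ico (k + 1) 0, v i := by
      rw [← Finset.insert_Ico_add_one_left_eq_Ico hk, Finset.prod_insert (by simp)]
    have h0 : ∏ i ∈ Finset.Ico (k + 1) 0, v i ≠ 0 := Finset.prod_ne_zero_iff.2 fun i _ => hv i
    rw [h]
    have := hv k
    field_simp

end Sequences

/-! ### Diagonal operators and the unweighted bilateral shift -/

section Shift

/-- The diagonal operator with entries bounded above and away from zero, as a topological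
automorphism of `ℓ²(ℤ)`. -/
theorem exists_diagonal_equiv {c : ℤ → ℂ} {m M : ℝ} (hm : 0 < m) (hmc : ∀ k, m ≤ ‖c k‖)
    (hcM : ∀ k, ‖c k‖ ≤ M) :
    ∃ D : EllTwo ≃L[ℂ] EllTwo, ∀ (ξ : EllTwo) (k : ℤ), D ξ k = c k * ξ k := by
  have hc : ∀ k, c k ≠ 0 := fun k => norm_pos_iff.1 (hm.trans_le (hmc k))
  have hM : 0 ≤ M := (norm_nonneg (c 0)).trans (hcM 0)
  have h1 : ∀ k, ‖ContinuousLinearMap.mul ℂ ℂ (c k)‖ ≤ M := fun k => by simpa using hcM k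
  have h2 : ∀ k, ‖ContinuousLinearMap.mul ℂ ℂ (c k)⁻¹‖ ≤ m⁻¹ := fun k => by
    simpa using inv_anti₀ hm (hmc k)
  refine ⟨ContinuousLinearEquiv.equivOfInverse
    (lp.mapCLM 2 (fun k => ContinuousLinearMap.mul ℂ ℂ (c k)) hM h1)
    (lp.mapCLM 2 (fun k => ContinuousLinearMap.mul ℂ ℂ (c k)⁻¹) (inv_nonneg.2 hm.le) h2)
    (fun ξ => ?_) (fun ξ => ?_), fun ξ k => ?_⟩
  · ext k
    simp [hc k]
  · ext k
    simp [hc k]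
  · simp

/-- The unweighted bilateral shift `e_k ↦ e_{k+1}` of `ℓ²(ℤ)`. -/
def bilateralShift : EllTwo ≃ₗᵢ[ℂ] EllTwo where
  toFun ξ := ⟨fun k => ξ (k - 1), memℓp_two_shift (lp.memℓp ξ)⟩
  invFun ξ := ⟨fun k => ξ (k + 1), by
    change Memℓp (fun k : ℤ => ξ (k + 1)) 2
    have h2 : 0 < (2 : ENNReal).toReal := by norm_num
    have hξ := lp.memℓp ξ
    rw [memℓp_gen_iff h2] at hξ ⊢
    exact (Equiv.summable_iff (Equiv.addRight (1 : ℤ))).mpr hξ⟩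
  map_add' _ _ := rfl
  map_smul' _ _ := rfl
  left_inv ξ := by ext k; simp
  right_inv ξ := by ext k; simp
  norm_map' ξ := by
    have h2 : 0 < (2 : ENNReal).toReal := by norm_num
    rw [lp.norm_eq_tsum_rpow h2, lp.norm_eq_tsum_rpow h2]
    congr 1
    exact (Equiv.subRight (1 : ℤ)).tsum_eq fun k => ‖ξ k‖ ^ (2 : ENNReal).toReal

@[simp]
theorem bilateralShift_apply (ξ : EllTwo) (k : ℤ) : bilateralShift ξ k = ξ (k - 1) := rfl

@[simp]
theorem bilateralShift_symm_apply (ξ : EllTwo) (k : ℤ) :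
    bilateralShift.symm ξ k = ξ (k + 1) := rfl

/-- The bilateral shift as a bounded operator. -/
abbrev bilateralShiftL : EllTwo →L[ℂ] EllTwo :=
  (bilateralShift.toContinuousLinearEquiv : EllTwo →L[ℂ] EllTwo)

theorem spectrum_conj {E : Type*} [NormedAddCommGroup E] [NormedSpace ℂ E] (D : E ≃L[ℂ] E)
    {A B : E →L[ℂ] E} (h : ∀ x, D (A x) = B (D x)) : spectrum ℂ B = spectrum ℂ A := by
  have hB : B = D.conjContinuousAlgEquiv A := by
    ext x
    simp [h]
  rw [hB]
  exact AlgEquiv.spectrum_eq D.conjContinuousAlgEquiv A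

instance : Nontrivial EllTwo :=
  ⟨lp.single 2 0 1, 0, fun h => by
    have h1 := congrArg (fun ξ : EllTwo => ξ 0) h
    simp at h1⟩

/-- The spectrum of the shift lies in the unit circle because the shift is unitary, and it is
invariant under rotations because `z U` is conjugate to `U` through the diagonal operator with
entries `z ^ k`, for every `z` of modulus `1`. -/
theorem spectrum_bilateralShift : spectrum ℂ bilateralShiftL = Metric.sphere (0 : ℂ) 1 := by
  have hsub : spectrum ℂ bilateralShiftL ⊆ Metric.sphere (0 : ℂ) 1 :=
    spectrum.subset_circle_of_unitary (Unitary.linearIsometryEquiv.symm bilateralShift).2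
  have hrot : ∀ z : ℂ, ‖z‖ = 1 → z • spectrum ℂ bilateralShiftL = spectrum ℂ bilateralShiftL := by
    intro z hz
    have hz0 : z ≠ 0 := norm_ne_zero_iff.1 (by rw [hz]; exact one_ne_zero)
    obtain ⟨D, hD⟩ := exists_diagonal_equiv (c := fun k => z ^ k) (m := 1) (M := 1) one_pos
      (fun k => by simp [hz]) (fun k => by simp [hz])
    have hnt : (spectrum ℂ bilateralShiftL).Nonempty := spectrum.nonempty _
    rw [← spectrum.smul_eq_smul z bilateralShiftL hnt]
    refine spectrum_conj D fun x => ?_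
    ext k
    simp [hD, ← mul_assoc, ← zpow_one_add₀ hz0]
  obtain ⟨u, hu⟩ : (spectrum ℂ bilateralShiftL).Nonempty := spectrum.nonempty _
  have hu1 : ‖u‖ = 1 := by simpa using hsub hu
  refine hsub.antisymm fun z hz => ?_
  have hz1 : ‖z‖ = 1 := by simpa using hz
  rw [← hrot (z / u) (by rw [norm_div, hz1, hu1, div_one])]
  refine ⟨u, hu, ?_⟩
  simp [div_mul_cancel₀ _ (norm_ne_zero_iff.1 (by rw [hu1]; exact one_ne_zero) : u ≠ 0)]

theorem pow_conj_apply {E : Type*} [NormedAddCommGroup E] [NormedSpace ℂ E] (D : E ≃L[ℂ] E)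
    {A B : E →L[ℂ] E} (h : ∀ x, D (A x) = B (D x)) (n : ℕ) (x : E) :
    (B ^ n) (D x) = D ((A ^ n) x) := by
  induction n generalizing x with
  | zero => simp
  | succ n ih => rw [pow_succ, pow_succ, mul_apply_eq_comp,
      mul_apply_eq_comp, ← h, ih]

theorem IsCyclicOperator.conj {E : Type*} [NormedAddCommGroup E] [InnerProductSpace ℂ E]
    (D : E ≃L[ℂ] E) {A B : E →L[ℂ] E} (h : ∀ x, D (A x) = B (D x))
    (hA : IsCyclicOperator A) : IsCyclicOperator B := by
  obtain ⟨x, hx⟩ := hA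
  refine ⟨D x, ?_⟩
  have := D.surjective.denseRange.dense_image D.continuous hx
  convert this
  rw [← ContinuousLinearEquiv.coe_coe, ← ContinuousLinearMap.coe_coe, ← Submodule.map_coe,
    Submodule.map_span, ← Set.range_comp]
  congr 3
  funext n
  exact pow_conj_apply D h n x

theorem IsCyclicOperator.const_smul {E : Type*} [NormedAddCommGroup E] [InnerProductSpace ℂ E]
    {A : E →L[ℂ] E} (hA : IsCyclicOperator A) {c : ℂ} (hc : c ≠ 0) :
    IsCyclicOperator (c • A) := by
  obtain ⟨x, hx⟩ := hA
  refine ⟨x, hx.mono ?_⟩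
  rw [SetLike.coe_subset_coe, Submodule.span_le]
  rintro _ ⟨n, rfl⟩
  have h : (A ^ n) x = (c ^ n)⁻¹ • ((c • A) ^ n) x := by
    rw [smul_pow, smul_apply, inv_smul_smul₀ (pow_ne_zero n hc)]
  change (A ^ n) x ∈ _
  rw [h]
  exact Submodule.smul_mem _ _ (Submodule.subset_span ⟨n, rfl⟩)

theorem IsSupercyclicOperator.conj {E : Type*} [NormedAddCommGroup E] [InnerProductSpace ℂ E]
    (D : E ≃L[ℂ] E) {A B : E →L[ℂ] E} (h : ∀ x, D (A x) = B (D x))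
    (hA : IsSupercyclicOperator A) : IsSupercyclicOperator B := by
  obtain ⟨x, hx⟩ := hA
  refine ⟨D x, (D.surjective.denseRange.dense_image D.continuous hx).mono ?_⟩
  rintro _ ⟨_, ⟨c, n, rfl⟩, rfl⟩
  exact ⟨c, n, by rw [map_smul, pow_conj_apply D h]⟩

/-- For a linear isometry `U` the quadratic forms `⟪y, U y⟫` and `‖y‖²` are multiplied by the same
factor `‖c‖²` when `y` is replaced by `c U^n y`. If some orbit were projectively dense, they would
therefore be proportional; testing on `e₀` and on `e₀ + e₁` shows that they are not. -/
theorem not_isSupercyclic_smul_bilateralShift (r : ℂ) :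
    ¬ IsSupercyclicOperator (r • bilateralShiftL) := by
  rintro ⟨x, hx⟩
  set Q : EllTwo → ℂ := fun y => inner ℂ y (bilateralShift y) with hQ
  have hQc : Continuous Q := by
    simp only [hQ]
    exact continuous_id.inner bilateralShift.continuous
  have hpow : ∀ n : ℕ, Q ((bilateralShiftL ^ n) x) = Q x ∧ ‖(bilateralShiftL ^ n) x‖ = ‖x‖ := by
    intro n
    induction n with
    | zero => simp
    | succ n ih =>
      rw [pow_succ', mul_apply_eq_comp]
      exact ⟨(bilateralShift.inner_map_map _ _).trans ih.1,
        (bilateralShift.norm_map _).trans ih.2⟩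
  have hall : (fun y : EllTwo => Q y * (‖x‖ : ℂ) ^ 2) = fun y => Q x * (‖y‖ : ℂ) ^ 2 := by
    refine Continuous.ext_on hx (by fun_prop) (by fun_prop) ?_
    rintro _ ⟨c, n, rfl⟩
    have h1 : c • ((r • bilateralShiftL) ^ n) x = (c * r ^ n) • (bilateralShiftL ^ n) x := by
      rw [smul_pow, smul_apply, smul_smul]
    have h2 : ∀ (a : ℂ) (y : EllTwo), Q (a • y) = (‖a‖ : ℂ) ^ 2 * Q y := by
      intro a y
      simp only [hQ, map_smul, inner_smul_left, inner_smul_right]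
      rw [← mul_assoc, Complex.conj_mul']
    simp only
    rw [h1, h2, (hpow n).1, norm_smul, (hpow n).2]
    push_cast
    ring
  have hev : ∀ y, Q y * (‖x‖ : ℂ) ^ 2 = Q x * (‖y‖ : ℂ) ^ 2 := fun y => congrFun hall y
  set e : ℤ → EllTwo := fun k => lp.single 2 k 1 with he
  have hU : ∀ k, bilateralShift (e k) = e (k + 1) := by
    intro k
    ext j
    simp only [he, bilateralShift_apply, lp.coeFn_single, Pi.single_apply]
    congr 1
    exact propext ⟨fun h => by omega, fun h => by omega⟩
  have hee : ∀ j k, inner ℂ (e j) (e k) = if j = k then (1 : ℂ) else 0 := by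
    intro j k
    simp only [he, lp.inner_single_left, lp.coeFn_single, Pi.single_apply]
    split_ifs <;> simp
  have hx0 : x ≠ 0 := by
    rintro rfl
    have h0 : (e 0) ∈ closure {y : EllTwo | ∃ (c : ℂ) (n : ℕ),
        y = c • ((r • bilateralShiftL) ^ n) 0} := hx (e 0)
    simp only [map_zero, smul_zero, exists_const, Set.ofPred_eq_eq_singleton, closure_singleton,
      Set.mem_singleton_iff] at h0
    have := hee 0 0
    simp [h0] at this
  have hq0 : Q (e 0) = 0 := by simp [hQ, hU, hee]
  have hq1 : Q (e 0 + e 1) = 1 := by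
    simp only [hQ, map_add, hU, inner_add_left, inner_add_right, hee]
    norm_num
  have hn0 : ‖e 0‖ = 1 := by simp [he, lp.norm_single]
  have h1 := hev (e 0)
  have h2 := hev (e 0 + e 1)
  rw [hq0, hn0] at h1
  have hQx : Q x = 0 := by simpa using h1.symm
  rw [hq1, hQx] at h2
  simp [hx0] at h2

end Shift

/-! ### Weighted shifts similar to a normal operator -/

section Similarity

/-- If `f_k = X e_k` and `g_k` is the biorthogonal family `(X⁻¹)* e_k`, then the intertwined normal
operator satisfies `N f_k = w_k f_{k+1}` and `N* g_{k+1} = conj w_k • g_k`; the norm inequalities for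
`N` and `N*` therefore pin down the moduli of the weights. -/
theorem exists_norm_weight_eq {w : ℤ → ℂ} (hw : ∀ k, w k ≠ 0) {N : EllTwo →ₗ.[ℂ] EllTwo}
    (hN : IsNormalOperator N) (hsim : AreSimilar (weightedShift w) N) :
    ∃ (d : ℤ → ℝ) (m M r : ℝ), 0 < m ∧ 0 < r ∧ (∀ k, m ≤ d k) ∧ (∀ k, d k ≤ M) ∧
      ∀ k, ‖w k‖ = r * (d k / d (k + 1)) := by
  obtain ⟨X, hdom, hint⟩ := hsim
  set e : ℤ → EllTwo := fun k => lp.single 2 k 1 with he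
  have hen : ∀ k, ‖e k‖ = 1 := fun k => by simp [he, lp.norm_single]
  have hedom : ∀ k, e k ∈ (weightedShift w).domain := by
    intro k
    change Memℓp (fun j : ℤ => w j * e k j) 2
    have : (fun j : ℤ => w j * e k j) = (w k • e k : EllTwo) := by
      funext j
      by_cases h : j = k
      · subst h; simp [he]
      · simp [he, h]
    rw [this]
    exact lp.memℓp _
  have hSe : ∀ k, weightedShift w ⟨e k, hedom k⟩ = w k • e (k + 1) := by
    intro k
    ext j
    change w (j - 1) * e k (j - 1) = w k * e (k + 1) j
    simp only [he, lp.coeFn_single, Pi.single_apply]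
    by_cases h : j - 1 = k
    · simp [← h]
    · rw [if_neg h, if_neg (by omega)]; simp
  have hmem : ∀ h ∈ (weightedShift w).domain, X h ∈ N.domain := fun h hh => by
    have : X h ∈ X '' ((weightedShift w).domain : Set EllTwo) := ⟨h, hh, rfl⟩
    rwa [hdom] at this
  set f : ℤ → EllTwo := fun k => X (e k) with hf
  set Y : EllTwo →L[ℂ] EllTwo :=
    ContinuousLinearMap.adjoint (X.symm : EllTwo →L[ℂ] EllTwo) with hY
  set g : ℤ → EllTwo := fun k => Y (e k) with hg
  have hfdom : ∀ k, f k ∈ N.domain := fun k => hmem _ (hedom k)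
  have hNf : ∀ k, N ⟨f k, hfdom k⟩ = w k • f (k + 1) := by
    intro k
    rw [← hint ⟨e k, hedom k⟩ ⟨f k, hfdom k⟩ rfl, hSe, map_smul]
  have hadj : ∀ k, ∀ x : N.domain,
      inner ℂ ((starRingEnd ℂ) (w k) • g k) (x : EllTwo) = inner ℂ (g (k + 1)) (N x) := by
    intro k x
    have hx : (x : EllTwo) ∈ X '' ((weightedShift w).domain : Set EllTwo) := by
      rw [hdom]; exact x.2
    obtain ⟨h, hh, hhx⟩ := hx
    rw [← hint ⟨h, hh⟩ x hhx.symm, ← hhx, inner_smul_left, hg, hY,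
      ContinuousLinearMap.adjoint_inner_left, ContinuousLinearMap.adjoint_inner_left]
    simp only [ContinuousLinearEquiv.coe_coe, ContinuousLinearEquiv.symm_apply_apply, he,
      lp.inner_single_left, Complex.conj_conj]
    change w k * inner ℂ 1 (h k) = inner ℂ 1 (w (k + 1 - 1) * h (k + 1 - 1))
    simp
  have hgdom' : ∀ k, g (k + 1) ∈ N†.domain := fun k =>
    LinearPMap.mem_adjoint_domain_of_exists _ ⟨_, hadj k⟩
  have hgdom : ∀ k, g k ∈ N†.domain := fun k => by simpa using hgdom' (k - 1)
  have hNg : ∀ k, N† ⟨g (k + 1), hgdom (k + 1)⟩ = (starRingEnd ℂ) (w k) • g k := fun k =>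
    LinearPMap.adjoint_apply_eq hN.dense_domain _ (hadj k)
  have hwpos : ∀ k, 0 < ‖w k‖ := fun k => norm_pos_iff.2 (hw k)
  have he0 : ∀ k, e k ≠ 0 := fun k => norm_ne_zero_iff.1 (by rw [hen]; exact one_ne_zero)
  have hfpos : ∀ k, 0 < ‖f k‖ := fun k => norm_pos_iff.2 (by simpa [hf] using he0 k)
  have hgf : ∀ k, inner ℂ (g k) (f k) = (1 : ℂ) := by
    intro k
    rw [hg, hY, ContinuousLinearMap.adjoint_inner_left]
    simp only [hf, ContinuousLinearEquiv.coe_coe, ContinuousLinearEquiv.symm_apply_apply]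
    rw [inner_self_eq_norm_sq_to_K, hen]
    simp
  have hgpos : ∀ k, 0 < ‖g k‖ := fun k => norm_pos_iff.2 fun h0 => by
    have := hgf k
    simp [h0] at this
  have hfle : ∀ k, ‖f k‖ ≤ ‖(X : EllTwo →L[ℂ] EllTwo)‖ := fun k => by
    simpa [hen] using (X : EllTwo →L[ℂ] EllTwo).le_opNorm (e k)
  have hgle : ∀ k, ‖g k‖ ≤ ‖Y‖ := fun k => by simpa [hen] using Y.le_opNorm (e k)
  obtain ⟨r, hr, h⟩ := exists_eq_mul_div_of_logConvex (a := fun k => ‖w k‖) (d := fun k => ‖f k‖)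
    (h := fun k => ‖g k‖) hwpos hfpos hgpos
    (C := ‖(X : EllTwo →L[ℂ] EllTwo)‖ * ‖Y‖)
    (fun k => mul_le_mul (hfle k) (hgle k) (norm_nonneg _) (norm_nonneg _))
    (fun k => by
      have h1 := hN.norm_apply_sq_le ⟨f k, hfdom k⟩ (w k • ⟨f (k + 1), hfdom (k + 1)⟩) (hNf k)
      rw [LinearPMap.map_smul, hNf, hNf, norm_smul, norm_smul, norm_smul] at h1
      rw [show k + 2 = k + 1 + 1 by ring]
      linarith)
    (fun k => by
      have h1 := hN.norm_adjoint_apply_sq_le ⟨g (k + 1 + 1), hgdom (k + 1 + 1)⟩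
        ((starRingEnd ℂ) (w (k + 1)) • ⟨g (k + 1), hgdom (k + 1)⟩) (hNg (k + 1))
      rw [LinearPMap.map_smul, hNg, hNg, norm_smul, norm_smul, norm_smul, RCLike.norm_conj,
        RCLike.norm_conj] at h1
      rw [show k + 2 = k + 1 + 1 by ring]
      linarith)
  have hS0 : ‖(X.symm : EllTwo →L[ℂ] EllTwo)‖ ≠ 0 := by
    intro h0
    have h1 := (X.symm : EllTwo →L[ℂ] EllTwo).le_opNorm (f 0)
    simp [h0, hf, he0] at h1
  have hSpos : 0 < ‖(X.symm : EllTwo →L[ℂ] EllTwo)‖ :=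
    lt_of_le_of_ne (norm_nonneg _) hS0.symm
  refine ⟨fun k => ‖f k‖, ‖(X.symm : EllTwo →L[ℂ] EllTwo)‖⁻¹, ‖(X : EllTwo →L[ℂ] EllTwo)‖, r,
    inv_pos.2 hSpos, hr, fun k => ?_, hfle, h⟩
  have h1 := (X.symm : EllTwo →L[ℂ] EllTwo).le_opNorm (f k)
  simp only [hf, ContinuousLinearEquiv.coe_coe, ContinuousLinearEquiv.symm_apply_apply, hen] at h1
  rw [inv_le_iff_one_le_mul₀' hSpos]
  exact h1

theorem weight_ne_zero_of_injective {w : ℤ → ℂ} (hinj : Function.Injective (weightedShift w))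
    (k : ℤ) : w k ≠ 0 := by
  intro h0
  set e : EllTwo := lp.single 2 k 1 with he
  have hz : ∀ j, w j * e j = 0 := by
    intro j
    by_cases h : j = k
    · rw [h, h0, zero_mul]
    · simp [he, h]
  have hedom : e ∈ (weightedShift w).domain := by
    change Memℓp (fun j : ℤ => w j * e j) 2
    simp only [hz]
    exact zero_memℓp
  have h1 : weightedShift w ⟨e, hedom⟩ = weightedShift w 0 := by
    rw [LinearPMap.map_zero]
    ext j
    exact hz (j - 1)
  have h2 : e k = 0 := by
    rw [show e = 0 from congrArg Subtype.val (hinj h1)]; rfl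
  simp [he] at h2

/-- If `|w_k| = r d_k / d_{k+1}` with `d` bounded above and away from zero, then the weighted shift
is everywhere defined and bounded, and a diagonal operator `D`, whose entries solve
`c_{k+1} = c_k w_k / r`, conjugates it to `r` times the unweighted shift. -/
theorem exists_similar_bilateralShift {w : ℤ → ℂ} (hw : ∀ k, w k ≠ 0) {d : ℤ → ℝ} {m M r : ℝ}
    (hm : 0 < m) (hr : 0 < r) (hmd : ∀ k, m ≤ d k) (hdM : ∀ k, d k ≤ M)
    (hwd : ∀ k, ‖w k‖ = r * (d k / d (k + 1))) :
    ∃ (T : EllTwo →L[ℂ] EllTwo) (D : EllTwo ≃L[ℂ] EllTwo),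
      weightedShift w = (T : EllTwo →ₗ[ℂ] EllTwo).toPMap ⊤ ∧
      ∀ x, D (((r : ℂ) • bilateralShiftL) x) = T (D x) := by
  have hr0 : (r : ℂ) ≠ 0 := by exact_mod_cast hr.ne'
  have hd : ∀ k, 0 < d k := fun k => hm.trans_le (hmd k)
  obtain ⟨c, hc0, hc⟩ := exists_int_mul_recursion (v := fun k => w k / r)
    fun k => div_ne_zero (hw k) hr0
  have hcd : ∀ k, ‖c k‖ * d k = d 0 := by
    have hstep : ∀ k, ‖c (k + 1)‖ * d (k + 1) = ‖c k‖ * d k := by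
      intro k
      have := (hd (k + 1)).ne'
      rw [hc, norm_mul, norm_div, hwd, Complex.norm_real, Real.norm_of_nonneg hr.le]
      field_simp
    intro k
    induction k using Int.induction_on with
    | zero => simp [hc0]
    | succ i ih => rw [hstep, ih]
    | pred i ih => rw [← ih, ← hstep, sub_add_cancel]
  have hM : 0 < M := (hd 0).trans_le (hdM 0)
  have hcn : ∀ k, ‖c k‖ = d 0 / d k := fun k => by rw [← hcd k, mul_div_cancel_right₀ _ (hd k).ne']
  obtain ⟨D, hD⟩ := exists_diagonal_equiv (c := c) (m := d 0 / M) (M := d 0 / m)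
    (div_pos (hd 0) hM)
    (fun k => by rw [hcn]; exact div_le_div_of_nonneg_left (hd 0).le (hd k) (hdM k))
    (fun k => by rw [hcn]; exact div_le_div_of_nonneg_left (hd 0).le hm (hmd k))
  set T : EllTwo →L[ℂ] EllTwo := D.conjContinuousAlgEquiv ((r : ℂ) • bilateralShiftL) with hT
  have hTD : ∀ x, D (((r : ℂ) • bilateralShiftL) x) = T (D x) := fun x => by simp [hT]
  have hTapp : ∀ (ξ : EllTwo) (k : ℤ), T ξ k = w (k - 1) * ξ (k - 1) := by
    intro ξ k
    obtain ⟨η, rfl⟩ := D.surjective ξ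
    rw [← hTD, hD, hD]
    have h1 : c k = c (k - 1) * (w (k - 1) / r) := by simpa using hc (k - 1)
    rw [smul_apply, lp.coeFn_smul, Pi.smul_apply, smul_eq_mul, h1]
    change c (k - 1) * (w (k - 1) / r) * (r * η (k - 1)) = _
    field_simp
  refine ⟨T, D, ?_, hTD⟩
  refine LinearPMap.ext ?_ ?_
  · refine eq_top_iff.2 fun ξ _ => ?_
    have h1 := lp.memℓp (bilateralShift.symm (T ξ))
    have h2 : ⇑(bilateralShift.symm (T ξ)) = fun k : ℤ => w k * ξ k := by
      funext k
      simp [hTapp]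
    rwa [h2] at h1
  · intro ξ h1 h2
    ext k
    exact (hTapp ξ k).symm

end Similarity

/-! ### A cyclic vector of the bilateral shift -/

section CyclicVector

open MeasureTheory AddCircle Filter Topology

/-- The real part of `2 s z / (1 - s z)` is `P_s(z) - 1`, with `P_s(z) = (1 - s²) / |1 - s z|²` the
Poisson kernel, and `P_s(z) ≤ 8 (1 - s) / |1 - z|²` on the unit circle. -/
theorem re_poisson_sub_one_le {z : ℂ} (hz : ‖z‖ = 1) (hz1 : z ≠ 1) {s n : ℝ} (hs0 : 0 ≤ s)
    (hs1 : s < 1) (hn : 0 ≤ n) (hns : 8 * n * (1 - s) ≤ 1) :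
    n * (2 * (s * z / (1 - s * z))).re ≤ (‖1 - z‖ ^ 2)⁻¹ - n := by
  set v : ℂ := 1 - s * z with hv
  have hsz : ‖(s : ℂ) * z‖ = s := by
    rw [norm_mul, hz, mul_one, Complex.norm_real, Real.norm_of_nonneg hs0]
  have hvs : 1 - s ≤ ‖v‖ := by
    have := norm_sub_norm_le (1 : ℂ) (s * z)
    rwa [norm_one, hsz] at this
  have hv0 : 0 < ‖v‖ := by linarith
  have hvne : v ≠ 0 := norm_pos_iff.1 hv0
  have h1z : 0 < ‖1 - z‖ := norm_pos_iff.2 (sub_ne_zero.2 hz1.symm)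
  have hle : ‖1 - z‖ ≤ 2 * ‖v‖ := by
    have h1 : 1 - z = v - ((1 - s : ℝ) : ℂ) * z := by rw [hv]; push_cast; ring
    have h2 : ‖((1 - s : ℝ) : ℂ) * z‖ = 1 - s := by
      rw [norm_mul, hz, mul_one, Complex.norm_real, Real.norm_of_nonneg (by linarith)]
    have h3 := norm_sub_le v (((1 - s : ℝ) : ℂ) * z)
    rw [← h1, h2] at h3
    linarith
  have hre : (2 * (s * z / v)).re = (1 - s ^ 2) / ‖v‖ ^ 2 - 1 := by
    have h1 : (s : ℂ) * z = 1 - v := by rw [hv]; ring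
    have h2 : s ^ 2 = 1 - 2 * v.re + ‖v‖ ^ 2 := by
      rw [← hsz, h1, ← Complex.normSq_eq_norm_sq, ← Complex.normSq_eq_norm_sq,
        Complex.normSq_apply, Complex.normSq_apply]
      simp
      ring
    have h3 : 2 * (s * z / v) = 2 * v⁻¹ - 2 := by
      rw [h1]; field_simp
    rw [h3, h2, Complex.sub_re, Complex.mul_re, Complex.inv_re, Complex.normSq_eq_norm_sq]
    have : ‖v‖ ^ 2 ≠ 0 := by positivity
    simp
    field_simp
    ring
  rw [hre, mul_sub, mul_one]
  gcongr
  rw [← mul_div_assoc, inv_eq_one_div, div_le_div_iff₀ (by positivity) (by positivity)]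
  have h4 : ‖1 - z‖ ^ 2 ≤ 4 * ‖v‖ ^ 2 := by nlinarith
  have h5 : n * (1 - s ^ 2) ≤ 2 * n * (1 - s) := by nlinarith [mul_nonneg hn (sq_nonneg (1 - s))]
  have h6 : 0 ≤ n * (1 - s ^ 2) := mul_nonneg hn (by nlinarith)
  calc n * (1 - s ^ 2) * ‖1 - z‖ ^ 2 ≤ (2 * n * (1 - s)) * (4 * ‖v‖ ^ 2) := by gcongr
    _ = (8 * n * (1 - s)) * ‖v‖ ^ 2 := by ring
    _ ≤ 1 * ‖v‖ ^ 2 := by gcongr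

variable {X : Type*} [TopologicalSpace X] [CompactSpace X]

theorem Subalgebra.exists_one_sub_mul_eq_one {A : Subalgebra ℂ C(X, ℂ)}
    (hA : IsClosed (A : Set C(X, ℂ))) {x : C(X, ℂ)} (hx : x ∈ A) (hx1 : ‖x‖ < 1) :
    ∃ a ∈ A, (1 - x) * a = 1 :=
  ⟨∑' n : ℕ, x ^ n,
    hA.mem_of_tendsto (summable_geometric_of_norm_lt_one hx1).hasSum
      (Eventually.of_forall fun _ => A.sum_mem fun n _ => A.pow_mem hx n),
    mul_neg_geom_series x hx1⟩

theorem Subalgebra.exists_exp_eq_one_add_mul [Nonempty X] {A : Subalgebra ℂ C(X, ℂ)}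
    (hA : IsClosed (A : Set C(X, ℂ))) {y : C(X, ℂ)} (hy : y ∈ A) :
    ∃ b ∈ A, ∀ t, Complex.exp (y t) = 1 + y t * b t := by
  have hsum : Summable fun n : ℕ => ((n + 1).factorial : ℂ)⁻¹ • y ^ n := by
    refine Summable.of_norm_bounded (Real.summable_pow_div_factorial ‖y‖) fun n => ?_
    rw [norm_smul, norm_inv, Complex.norm_natCast, inv_mul_eq_div]
    gcongr
    · exact norm_pow_le y n
    · exact n.le_succ
  refine ⟨_, hA.mem_of_tendsto hsum.hasSum (Eventually.of_forall fun _ =>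
    A.sum_mem fun n _ => A.smul_mem (A.pow_mem hy n) _), fun t => ?_⟩
  have h1 := (hsum.hasSum.mapL (ContinuousMap.evalCLM ℂ t)).mul_left (y t)
  have h2 := NormedSpace.exp_series_hasSum_exp' (𝕂 := ℂ) (y t)
  rw [← hasSum_nat_add_iff' 1, ← Complex.exp_eq_exp_ℂ] at h2
  have h3 : (fun n : ℕ => y t * ContinuousMap.evalCLM ℂ t (((n + 1).factorial : ℂ)⁻¹ • y ^ n))
      = fun n : ℕ => ((n + 1).factorial : ℂ)⁻¹ • y t ^ (n + 1) := by
    funext n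
    simp only [ContinuousMap.evalCLM_apply, ContinuousMap.smul_apply, ContinuousMap.pow_apply,
      smul_eq_mul]
    ring
  rw [h3] at h1
  have h4 := h1.unique h2
  simp only [ContinuousMap.evalCLM_apply, Finset.range_one, Finset.sum_singleton, pow_zero,
    Nat.factorial_zero, Nat.cast_one, inv_one, smul_eq_mul, mul_one] at h4
  rw [h4]
  ring

/-- The continuous function `exp (-1 / |1 - z|²)` on the circle, extended by `0` to the point
`z = 1`. Its logarithm is not integrable, which is what makes it cyclic. -/
def cyclicFunction : C(UnitAddCircle, ℂ) where
  toFun t := (expNegInvGlue (‖1 - fourier 1 t‖ ^ 2) : ℂ)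
  continuous_toFun := by
    have h : Continuous expNegInvGlue := (expNegInvGlue.contDiff (n := 0)).continuous
    fun_prop

theorem cyclicFunction_apply (t : UnitAddCircle) :
    cyclicFunction t = (expNegInvGlue (‖1 - fourier 1 t‖ ^ 2) : ℂ) := rfl

/-- On the circle, `1 / z` is approximated by elements `b` of the closed algebra generated by `z`
in the uniform norm weighted by the cyclic function. Here `1 - z b = exp (n (P_s + i Q_s - 1))` with
the Poisson kernel `P_s` and its conjugate `Q_s`: this function equals `1` at the origin of the
disc, it has modulus about `exp (-n)` away from the point `1` when `s` is close to `1`, and the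
cyclic function absorbs its peak at the point `1`. -/
theorem exists_mem_elemental_norm_le (n : ℕ) :
    ∃ b ∈ Algebra.elemental ℂ (fourier 1 : C(UnitAddCircle, ℂ)), ∀ t,
      ‖(1 - fourier 1 t * b t) * cyclicFunction t‖ ≤ Real.exp (-n) := by
  set z : C(UnitAddCircle, ℂ) := fourier 1 with hz
  set A := Algebra.elemental ℂ z with hA
  have hAc : IsClosed (A : Set C(UnitAddCircle, ℂ)) := Algebra.elemental.isClosed ℂ z
  have hzA : z ∈ A := Algebra.elemental.self_mem ℂ z
  -- the choice of `s` makes `8 n (1 - s) ≤ 1`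
  set s : ℝ := 1 - (8 * ((n : ℝ) + 1))⁻¹ with hs
  have hinv : (8 * ((n : ℝ) + 1))⁻¹ ≤ 1 :=
    inv_le_one_of_one_le₀ (by linarith [n.cast_nonneg (α := ℝ)])
  have hinvpos : 0 < (8 * ((n : ℝ) + 1))⁻¹ := by positivity
  have hs0 : 0 ≤ s := by linarith
  have hs1 : s < 1 := by linarith
  have hns : 8 * (n : ℝ) * (1 - s) ≤ 1 := by
    rw [hs, sub_sub_cancel, ← div_eq_mul_inv, div_le_one (by positivity)]
    linarith
  have hznorm : ∀ t, ‖z t‖ = 1 := fun t => by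
    rw [hz, fourier_apply]; exact Circle.norm_coe _
  have hx1 : ‖(s : ℂ) • z‖ < 1 := by
    rw [norm_smul, hz, fourier_norm, mul_one, Complex.norm_real, Real.norm_of_nonneg hs0]
    exact hs1
  obtain ⟨a, haA, ha⟩ := Subalgebra.exists_one_sub_mul_eq_one hAc (A.smul_mem hzA (s : ℂ)) hx1
  set c : C(UnitAddCircle, ℂ) := (2 * n * s : ℂ) • a with hc
  have hcA : c ∈ A := A.smul_mem haA _
  obtain ⟨b, hbA, hb⟩ := Subalgebra.exists_exp_eq_one_add_mul hAc (A.mul_mem hzA hcA)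
  refine ⟨-(c * b), A.neg_mem (A.mul_mem hcA hbA), fun t => ?_⟩
  have h1 : 1 - z t * (-(c * b)) t = Complex.exp ((z * c) t) := by
    rw [hb]
    simp
    ring
  rw [h1, norm_mul, Complex.norm_exp, cyclicFunction_apply, Complex.norm_real,
    Real.norm_of_nonneg (expNegInvGlue.nonneg _), ← hz]
  by_cases hzt : z t = 1
  · rw [hzt, sub_self, norm_zero, expNegInvGlue.zero_of_nonpos (by simp), mul_zero]
    positivity
  · have hpos : 0 < ‖1 - z t‖ ^ 2 := by
      have := norm_pos_iff.2 (sub_ne_zero.2 (Ne.symm hzt))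
      positivity
    have hat : (1 - s * z t) * a t = 1 := by simpa using DFunLike.congr_fun ha t
    have hne : 1 - s * z t ≠ 0 := left_ne_zero_of_mul_eq_one hat
    have hy : (z * c) t = (n : ℝ) * (2 * (s * z t / (1 - s * z t))) := by
      have : a t = (1 - s * z t)⁻¹ := eq_inv_of_mul_eq_one_right hat
      simp only [hc, ContinuousMap.mul_apply, ContinuousMap.smul_apply, smul_eq_mul, this]
      push_cast
      field_simp
    rw [hy, Complex.re_ofReal_mul, expNegInvGlue, if_neg hpos.not_ge, ← Real.exp_add]
    refine Real.exp_le_exp.2 ?_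
    have := re_poisson_sub_one_le (hznorm t) hzt hs0 hs1 n.cast_nonneg hns
    linarith

/-- A closed subspace containing the nonnegative Fourier monomials times the cyclic function
contains all multiples of the cyclic function. -/
theorem mul_cyclicFunction_mem {N : Submodule ℂ C(UnitAddCircle, ℂ)}
    (hN : IsClosed (N : Set C(UnitAddCircle, ℂ)))
    (hmem : ∀ n : ℕ, fourier n * cyclicFunction ∈ N) (F : C(UnitAddCircle, ℂ)) :
    F * cyclicFunction ∈ N := by
  set z : C(UnitAddCircle, ℂ) := fourier 1 with hz
  set zi : C(UnitAddCircle, ℂ) := fourier (-1) with hzi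
  have hzz : zi * z = 1 := by
    ext t
    rw [ContinuousMap.mul_apply, hz, hzi, ← fourier_add]
    simp
  have hpow : ∀ n : ℕ, z ^ n = fourier n := by
    intro n
    induction n with
    | zero => ext t; simp
    | succ n ih =>
      ext t
      rw [pow_succ, ih, ContinuousMap.mul_apply, hz, ← fourier_add]
      push_cast
      rfl
  have hipow : ∀ n : ℕ, zi ^ n = fourier (-n) := by
    intro n
    induction n with
    | zero => ext t; simp
    | succ n ih =>
      ext t
      rw [pow_succ, ih, ContinuousMap.mul_apply, hzi, ← fourier_add]
      push_cast
      rw [neg_add]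
  -- `K` is the closed space of multipliers of the cyclic function into `N`; it contains the closed
  -- algebra generated by `z`, and the approximation of `1 / z` puts the negative powers into it.
  set K : Submodule ℂ C(UnitAddCircle, ℂ) := N.comap (LinearMap.mulRight ℂ cyclicFunction) with hK
  have hKmem : ∀ G, G ∈ K ↔ G * cyclicFunction ∈ N := fun G => Iff.rfl
  have hKc : IsClosed (K : Set C(UnitAddCircle, ℂ)) :=
    hN.preimage (f := fun G : C(UnitAddCircle, ℂ) => G * cyclicFunction) (by fun_prop)
  set A := Algebra.elemental ℂ z with hA
  have hbase : ∀ G ∈ A, G ∈ K := by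
    intro G hG
    refine closure_minimal (s := (Algebra.adjoin ℂ {z} : Set C(UnitAddCircle, ℂ))) ?_ hKc hG
    intro P hP
    have hP' : P ∈ Subalgebra.toSubmodule (Algebra.adjoin ℂ {z}) := hP
    rw [Algebra.adjoin_eq_span] at hP'
    refine Submodule.span_le.2 ?_ hP'
    intro Q hQ
    obtain ⟨n, rfl⟩ := Submonoid.mem_closure_singleton.1 hQ
    rw [SetLike.mem_coe, hKmem, hpow]
    exact hmem n
  have hstep : ∀ k : ℕ, ∀ G ∈ A, zi ^ k * G ∈ K := by
    intro k
    induction k with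
    | zero => simpa using hbase
    | succ k ih =>
      intro G hG
      choose b hbA hb using exists_mem_elemental_norm_le
      have hlim : Tendsto (fun n => zi ^ k * (b n * G) * cyclicFunction) atTop
          (𝓝 (zi ^ (k + 1) * G * cyclicFunction)) := by
        have hexp : Tendsto (fun n : ℕ => ‖G‖ * Real.exp (-n)) atTop (𝓝 0) := by
          simpa using (Real.tendsto_exp_neg_atTop_nhds_zero.comp
            tendsto_natCast_atTop_atTop).const_mul ‖G‖
        rw [tendsto_iff_norm_sub_tendsto_zero]
        refine squeeze_zero (fun _ => norm_nonneg _) (fun n => ?_) hexp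
        rw [ContinuousMap.norm_le _ (by positivity)]
        intro t
        have h1 : (zi ^ k * (b n * G) * cyclicFunction - zi ^ (k + 1) * G * cyclicFunction) t
            = -(zi t ^ (k + 1)) * G t * ((1 - z t * b n t) * cyclicFunction t) := by
          have h2 : zi t * z t = 1 := DFunLike.congr_fun hzz t
          simp only [ContinuousMap.sub_apply, ContinuousMap.mul_apply, ContinuousMap.pow_apply]
          linear_combination (-(zi t) ^ k * G t * b n t * cyclicFunction t) * h2
        have h3 : ‖zi t‖ = 1 := by rw [hzi, fourier_apply]; exact Circle.norm_coe _
        rw [h1, norm_mul, norm_mul, norm_neg, norm_pow, h3, one_pow, one_mul]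
        exact mul_le_mul (G.norm_coe_le_norm t) (hb n t) (norm_nonneg _) (norm_nonneg _)
      exact hN.mem_of_tendsto hlim (Eventually.of_forall fun n => ih _ (A.mul_mem (hbA n) hG))
  have hfour : ∀ k : ℤ, (fourier k : C(UnitAddCircle, ℂ)) ∈ K := by
    intro k
    obtain ⟨n, rfl | rfl⟩ := k.eq_nat_or_neg
    · exact hmem n
    · have := hstep n 1 A.one_mem
      rwa [mul_one, hipow] at this
  have htop : (⊤ : Submodule ℂ C(UnitAddCircle, ℂ)) ≤ K := by
    rw [← span_fourier_closure_eq_top]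
    refine Submodule.topologicalClosure_minimal _ (Submodule.span_le.2 ?_) hKc
    rintro _ ⟨k, rfl⟩
    exact hfour k
  exact htop (Submodule.mem_top (x := F))

theorem cyclicFunction_ne_zero {t : UnitAddCircle} (ht : t ≠ 0) : cyclicFunction t ≠ 0 := by
  have h1 : fourier 1 t ≠ (1 : ℂ) := by
    rw [fourier_one]
    intro h
    refine ht (injective_toCircle (T := 1) one_ne_zero (Subtype.ext ?_))
    rw [h, toCircle_zero]
    rfl
  have h2 := norm_pos_iff.2 (sub_ne_zero.2 h1.symm)
  rw [cyclicFunction_apply, Complex.ofReal_ne_zero]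
  exact (expNegInvGlue.pos_of_pos (by positivity)).ne'

instance : NullSingletonClass (haarAddCircle (T := 1)) where
  measure_singleton t := by
    have h : (volume : Measure UnitAddCircle) = haarAddCircle := by
      rw [volume_eq_smul_haarAddCircle]
      simp
    rw [← h, ← Metric.closedBall_zero, AddCircle.volume_closedBall]
    simp

/-- An `L²` function orthogonal to all nonnegative Fourier monomials times the cyclic function is
zero. -/
theorem eq_zero_of_inner_fourier_mul_cyclicFunction {y : Lp ℂ 2 (haarAddCircle (T := 1))}
    (hy : ∀ n : ℕ,
      inner ℂ y (ContinuousMap.toLp 2 haarAddCircle ℂ (fourier n * cyclicFunction)) = 0) :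
    y = 0 := by
  set J := ContinuousMap.toLp (E := ℂ) 2 (haarAddCircle (T := 1)) ℂ with hJ
  set N : Submodule ℂ C(UnitAddCircle, ℂ) := (innerSL ℂ y ∘L J).ker with hN
  have hall : ∀ F : C(UnitAddCircle, ℂ), inner ℂ y (J (F * cyclicFunction)) = 0 := fun F =>
    mul_cyclicFunction_mem (N := N) (innerSL ℂ y ∘L J).isClosed_ker hy F
  have hbdd : MemLp cyclicFunction ⊤ (haarAddCircle (T := 1)) :=
    memLp_top_of_bound cyclicFunction.continuous.aestronglyMeasurable _
      (Eventually.of_forall cyclicFunction.norm_coe_le_norm)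
  have hmem : MemLp (fun t => cyclicFunction t * y t) 2 (haarAddCircle (T := 1)) :=
    (Lp.memLp y).mul' hbdd
  have hreal : ∀ t, (starRingEnd ℂ) (cyclicFunction t) = cyclicFunction t := fun t =>
    Complex.conj_ofReal _
  -- The cyclic function is real, so it can be moved to the other side of the inner product.
  have hzero : hmem.toLp = 0 := by
    refine (ContinuousMap.toLp_denseRange ℂ (haarAddCircle (T := 1)) ℂ
      (p := 2) (by simp)).eq_zero_of_inner_left ℂ fun F => ?_
    rw [← hall F, L2.inner_def, L2.inner_def]
    refine integral_congr_ae ?_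
    filter_upwards [hmem.coeFn_toLp, ContinuousMap.coeFn_toLp (p := 2) (𝕜 := ℂ) haarAddCircle F,
      ContinuousMap.coeFn_toLp (p := 2) (𝕜 := ℂ) haarAddCircle (F * cyclicFunction)] with t h1 h2 h3
    rw [h1, h2, hJ, h3]
    simp [hreal]
    ring
  rw [Lp.eq_zero_iff_ae_eq_zero]
  have hne : ∀ᵐ t ∂(haarAddCircle (T := 1)), t ≠ 0 := by
    simp [ae_iff]
  have h0 := hmem.coeFn_toLp
  rw [hzero] at h0
  filter_upwards [h0, Lp.coeFn_zero ℂ 2 (haarAddCircle (T := 1)), hne] with t h1 h2 h3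
  rw [h2] at h1
  exact (mul_eq_zero.1 h1.symm).resolve_left (cyclicFunction_ne_zero h3)

/-- In terms of Fourier coefficients, multiplication by `z` on the circle is the bilateral shift. -/
theorem bilateralShift_repr_toLp (F : C(UnitAddCircle, ℂ)) :
    bilateralShift (fourierBasis.repr (ContinuousMap.toLp 2 (haarAddCircle (T := 1)) ℂ F))
      = fourierBasis.repr (ContinuousMap.toLp 2 (haarAddCircle (T := 1)) ℂ (fourier 1 * F)) := by
  ext k
  rw [bilateralShift_apply, fourierBasis_repr, fourierBasis_repr, fourierCoeff_toLp,
    fourierCoeff_toLp, fourierCoeff, fourierCoeff]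
  congr 1
  funext t
  rw [show -(k - 1) = -k + 1 by ring, fourier_add]
  simp [mul_assoc]

/-- The sequence of Fourier coefficients of the cyclic function is a cyclic vector of the shift. -/
theorem isCyclicOperator_bilateralShift : IsCyclicOperator bilateralShiftL := by
  set J : C(UnitAddCircle, ℂ) → EllTwo := fun F =>
    fourierBasis.repr (ContinuousMap.toLp 2 (haarAddCircle (T := 1)) ℂ F) with hJ
  have horbit : ∀ n : ℕ, (bilateralShiftL ^ n) (J cyclicFunction) =
      J (fourier n * cyclicFunction) := by
    intro n
    induction n with
    | zero =>
      have h : (fourier ((0 : ℕ) : ℤ) : C(UnitAddCircle, ℂ)) * cyclicFunction = cyclicFunction := by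
        ext t
        simp
      rw [h, pow_zero, one_apply_eq_self]
    | succ n ih =>
      rw [pow_succ', mul_apply_eq_comp, ih]
      refine (bilateralShift_repr_toLp _).trans ?_
      simp only [hJ]
      congr 2
      ext t
      simp only [ContinuousMap.mul_apply]
      rw [← mul_assoc, ← fourier_add]
      push_cast
      rw [add_comm]
  refine ⟨J cyclicFunction, ?_⟩
  rw [Submodule.dense_iff_topologicalClosure_eq_top, Submodule.topologicalClosure_eq_top_iff,
    Submodule.eq_bot_iff]
  intro η hη
  obtain ⟨y, rfl⟩ := (fourierBasis (T := 1)).repr.surjective η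
  rw [eq_zero_of_inner_fourier_mul_cyclicFunction (y := y) fun n => ?_, map_zero]
  rw [← (fourierBasis (T := 1)).repr.inner_map_map]
  refine (Submodule.mem_orthogonal' _ _).1 hη _ (Submodule.subset_span ⟨n, ?_⟩)
  exact horbit n

end CyclicVector

end

theorem mainTheorem2 (w : ℤ → ℂ)
    (hinj : Function.Injective (weightedShift w))
    (hsim : ∃ N : EllTwo →ₗ.[ℂ] EllTwo, IsNormalOperator N ∧ AreSimilar (weightedShift w) N) :
    ∃ T : EllTwo →L[ℂ] EllTwo,
      weightedShift w = (T : EllTwo →ₗ[ℂ] EllTwo).toPMap ⊤ ∧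
      IsCyclicOperator T ∧
      ¬ IsSupercyclicOperator T ∧
      ∃ r : ℝ, 0 < r ∧ spectrum ℂ T = Metric.sphere (0 : ℂ) r := by
  obtain ⟨N, hN, hwN⟩ := hsim
  have hw := weight_ne_zero_of_injective hinj
  obtain ⟨d, m, M, r, hm, hr, hmd, hdM, hwd⟩ := exists_norm_weight_eq hw hN hwN
  obtain ⟨T, D, hT, hTD⟩ := exists_similar_bilateralShift hw hm hr hmd hdM hwd
  have hr0 : (r : ℂ) ≠ 0 := by exact_mod_cast hr.ne'
  refine ⟨T, hT, (isCyclicOperator_bilateralShift.const_smul hr0).conj D hTD, fun h => ?_,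
    r, hr, ?_⟩
  · refine not_isSupercyclic_smul_bilateralShift r (h.conj D.symm fun x => ?_)
    rw [ContinuousLinearEquiv.symm_apply_eq, hTD, ContinuousLinearEquiv.apply_symm_apply]
  · have hne : (spectrum ℂ bilateralShiftL).Nonempty := spectrum.nonempty _
    rw [spectrum_conj D hTD, spectrum.smul_eq_smul _ _ hne, spectrum_bilateralShift,
      smul_sphere' hr0]
    simp [abs_of_pos hr]
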